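/- Let $G=(V,E)$ be a finite graph, possibly with loops or multiple edges (a loop contributes $2$ to the degree of its vertex). For $H\subseteq E$ let $\deg(H,v)$ be the degree of $v$ in $(V,H)$, and $\deg(G,v)=\deg(E,v)$. Given complex edge weights $\boldsymbol\lambda=(\lambda_e)_{e\in E}$ and complex activities $\mathbf u^{(v)}=(u^{(v)}_0,\dots,u^{(v)}_{\deg(G,v)})$ for $v\in V$, put $$Z(G,\boldsymbol\lambda,\mathbf u;\mathbf x)=\sum_{H\subseteq E}\Big(\prod_{e\in H}\lambda_e\Big)\prod_{v\in V}u^{(v)}_{\deg(H,v)}x_v^{\deg(H,v)},\qquad K_v(z)=\sum_{j=0}^{\deg(G,v)}\binom{\deg(G,v)}{j}u^{(v)}_jz^j .$$ Write $Z(G,\boldsymbol\lambda,\mathbf u;y^{1/2}\mathbf 1)$ for the polynomial in $y$ obtained from $Z$ by setting every $x_v=y^{1/2}$ (it is a polynomial in $y$, and does not depend on the choice of the square root, because $\sum_v\deg(H,v)=2\,\#H$). (1) Suppose that $|\lambda_e|=1$ for all $e\in E$ and that, for every $v\in V$, $\deg K_v=\deg(G,v)$ (in particular $K_v\neq0$)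 and every zero of $K_v$ has modulus $1$. Then $Z(G,\boldsymbol\lambda,\mathbf u;\mathbf x)\ne0$ whenever $|x_v|<1$ for all $v\in V$, and also whenever $|x_v|>1$ for all $v\in V$; and every zero of $Z(G,\boldsymbol\lambda,\mathbf u;y^{1/2}\mathbf 1)$ has modulus $1$. (2) If $K_v(z)=1+z+\cdots+z^{\deg(G,v)}$ for all $v\in V$, then the hypotheses of (1) on the keys $K_v$ hold, and for $\boldsymbol\lambda\equiv\mathbf 1$ $$Z(G,\mathbf 1,\mathbf u;y^{1/2}\mathbf 1)=\sum_{H\subseteq E}\frac{y^{\#H}}{\prod_{v\in V}\binom{\deg(G,v)}{\deg(H,v)}} .$$ Consequently every zero $y\in\mathbb C$ of the right-hand side has modulus $1$. (3) Let $k\ge1$ be an integer and $t$ a real number with $4t\ge\binom{2k}{k}^2$. Then every zero of $K(z)=1+\binom{2k}{k}z^k+t\,z^{2k}$ has modulus $\kappa=t^{-1/(2k)}$. If moreover $G$ is $2k$-regular, $|\lambda_e|=1$ for all $e\in E$ and $K_v=K$ for all $v\in V$, then $Z(G,\boldsymbol\lambda,\mathbf u;\mathbf x)\neq0$ whenever $|x_v|<\kappa$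 for all $v\in V$, and also whenever $|x_v|>\kappa$ for all $v\in V$; and every zero of $Z(G,\boldsymbol\lambda,\mathbf u;y^{1/2}\mathbf 1)$ has modulus $t^{-1/k}$. -/

import Mathlib

open Polynomial

namespace SubgraphZeros

variable {α β : Type*}

/-- `deg(H,v)`: the degree of the vertex `v` in the spanning subgraph of the multigraph `G` with
edge set `H`. A loop at `v` contributes `2`. The degree `deg(G,v)` is `deg G G.edgeSet v`. -/
noncomputable def deg (G : Graph α β) (H : Set β) (v : α) : ℕ :=
  {e | e ∈ H ∧ G.Inc e v}.ncard + {e | e ∈ H ∧ G.IsLoopAt e v}.ncard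

/-- The key polynomial `K_v(z) = ∑_{j=0}^d (d choose j) u_j^{(v)} z^j` with `d = deg(G,v)`.
Only the activities `u v 0, …, u v d` are used. -/
noncomputable def keyPoly (G : Graph α β) (u : α → ℕ → ℂ) (v : α) : ℂ[X] :=
  ∑ j ∈ Finset.range (deg G G.edgeSet v + 1),
    C (((deg G G.edgeSet v).choose j : ℂ) * u v j) * X ^ j

/-- `Z(G,λ,u;x) = ∑_{H ⊆ E} λ^H u_{deg(H)} x^{deg(H)}` for a finite multigraph `G`. -/
noncomputable def partitionPoly (G : Graph α β) (hV : G.vertexSet.Finite) (hE : G.edgeSet.Finite)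
    (lam : β → ℂ) (u : α → ℕ → ℂ) : MvPolynomial α ℂ :=
  ∑ H ∈ hE.toFinset.powerset,
    MvPolynomial.C ((∏ e ∈ H, lam e) * ∏ v ∈ hV.toFinset, u v (deg G (H : Set β) v)) *
      ∏ v ∈ hV.toFinset, MvPolynomial.X v ^ deg G (H : Set β) v

/-- `P(y) = F(y^{1/2} 1)`: the univariate polynomial `P` has, at each `y`, the value of `F` when
all variables are set equal to `s`, for every square root `s` of `y`. Such a `P` is unique. -/
def IsSqrtDiagonal (F : MvPolynomial α ℂ) (P : ℂ[X]) : Prop :=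
  ∀ y s : ℂ, s ^ 2 = y → P.eval y = MvPolynomial.eval (fun _ => s) F

/-- `∑_{H ⊆ E} y^{#H} / ∏_v (deg(G,v) choose deg(H,v))`. -/
noncomputable def binomialSum (G : Graph α β) (hV : G.vertexSet.Finite) (hE : G.edgeSet.Finite)
    (y : ℂ) : ℂ :=
  ∑ H ∈ hE.toFinset.powerset,
    y ^ H.card / ∏ v ∈ hV.toFinset, ((deg G G.edgeSet v).choose (deg G (H : Set β) v) : ℂ)

end SubgraphZeros

/-! The graph is built one edge at a time. Call a key stable if it has no zero in the closed unit
disc. By Laguerre's theorem its polar derivative at a point ξ with |ξ| ≤ 1 is stable again; on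
activities this is u_j ↦ u_j + ξ u_{j+1}, with the degree lowered by one (`IsDiscStable.polar`).

Let e be a new edge with ends a, b, let Z_E be the partition function of the old edges and S_a, S_b
the shifts of the activities at a, b. Polar derivatives at both ends, with the same ξ, and the
induction hypothesis give Z_E(u) + ξ (Z_E(S_a u) + Z_E(S_b u)) + ξ² Z_E(S_b S_a u) ≠ 0 for |ξ| ≤ 1.
Comparing outer coefficients, |Z_E(S_b S_a u)| < |Z_E(u)|, so Z_E(u) + λ_e Z_E(S_b S_a u), the
partition function with e added, is nonzero when |λ_e| ≤ 1 (`partitionSum_ne_zero`).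

The variables x_v are absorbed into the activities, which settles the inside of the disc.
Complementing edge sets reverses the activities and exchanges inside and outside. On the diagonal
only radius r is left for s, hence r² for y = s². The special keys have their zeros on a circle by
roots of unity in (2) and by a quadratic in z^k in (3). -/

namespace SubgraphZeros

/-! ### Laguerre's theorem -/

/-- The set of pairs `(m, s)` with `‖s‖ < ‖m - z s‖` and `m ≥ 0` is a convex cone for `‖z‖ ≤ 1`. -/
theorem normSq_sum_lt_of_forall {z : ℂ} (hz : ‖z‖ ≤ 1) (M : Multiset ℂ) (hM : M ≠ 0)
    (h : ∀ w ∈ M, Complex.normSq w < Complex.normSq (1 - z * w)) :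
    Complex.normSq M.sum < Complex.normSq (M.card - z * M.sum) := by
  have hz' : Complex.normSq z ≤ 1 := by
    rw [Complex.normSq_eq_norm_sq]; exact pow_le_one₀ (norm_nonneg _) hz
  induction M using Multiset.induction_on with
  | empty => exact absurd rfl hM
  | cons w M ih =>
    have hw := h w (Multiset.mem_cons_self _ _)
    rcases eq_or_ne M 0 with rfl | hM0
    · simpa using hw
    have hs := ih hM0 fun v hv => h v (Multiset.mem_cons_of_mem hv)
    have hm : (0 : ℝ) < M.card := by exact_mod_cast Multiset.card_pos.2 hM0
    rw [Multiset.sum_cons, Multiset.card_cons]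
    generalize M.sum = s at hs ⊢
    push_cast
    have hmc : ((M.card : ℕ) : ℂ) = (((M.card : ℕ) : ℝ) : ℂ) := by simp
    rw [hmc] at hs ⊢
    generalize ((M.card : ℕ) : ℝ) = m at hs hm ⊢
    obtain ⟨a, b⟩ := z
    obtain ⟨p, q⟩ := s
    obtain ⟨c, d⟩ := w
    simp only [Complex.normSq_apply, Complex.sub_re, Complex.sub_im, Complex.mul_re,
      Complex.mul_im, Complex.add_re, Complex.add_im, Complex.one_re, Complex.one_im,
      Complex.ofReal_re, Complex.ofReal_im] at *
    -- With f(m, s) = |m - z s|² - |s|², the three facts add up through the identity m f(m+1, s+w) =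
    -- (m+1) f(m, s) + m (m+1) f(1, w) + (1 - |z|²) |s - m w|².
    have hk : 0 ≤ (1 - (a * a + b * b)) * ((p - m * c) ^ 2 + (q - m * d) ^ 2) :=
      mul_nonneg (by linarith) (by positivity)
    have h1 := mul_pos (mul_pos hm (add_pos hm one_pos)) (sub_pos.2 hw)
    have h2 := mul_pos (add_pos hm one_pos) (sub_pos.2 hs)
    refine lt_of_mul_lt_mul_left (a := m) ?_ hm.le
    nlinarith [hk, h1, h2]

/-- Laguerre's theorem for the closed unit disc. -/
theorem laguerre_ne_zero {p : ℂ[X]} {n : ℕ} (hn : n ≠ 0) (hp : p.natDegree ≤ n)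
    (h : ∀ z : ℂ, ‖z‖ ≤ 1 → p.eval z ≠ 0) {z ξ : ℂ} (hz : ‖z‖ ≤ 1) (hξ : ‖ξ‖ ≤ 1) :
    (n : ℂ) * p.eval z + (ξ - z) * p.derivative.eval z ≠ 0 := by
  intro h0
  have hpz := h z hz
  have hlog := (IsAlgClosed.splits p).eval_derivative_div_eval_of_ne_zero hpz
  -- The zeros padding `M` to cardinality `n` stand for roots of `p` at infinity.
  set M : Multiset ℂ := p.roots.map (fun r => 1 / (z - r)) + Multiset.replicate (n - p.roots.card) 0
    with hMdef
  have hcard : M.card = n := by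
    have := p.card_roots'
    simp [hMdef]; omega
  have hsum : M.sum = p.derivative.eval z / p.eval z := by
    rw [hlog, hMdef]; simp
  have hM : M ≠ 0 := by
    rw [← Multiset.card_pos, hcard]; omega
  have key := normSq_sum_lt_of_forall hz M hM (by
    intro w hw
    rw [hMdef, Multiset.mem_add, Multiset.mem_map, Multiset.mem_replicate] at hw
    rcases hw with ⟨r, hr, rfl⟩ | ⟨-, rfl⟩
    · have hr0 : p.eval r = 0 := isRoot_of_mem_roots hr
      have hr1 : 1 < ‖r‖ := by
        by_contra hle
        exact h r (not_lt.1 hle) hr0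
      have hzr : z - r ≠ 0 := by
        intro hzr
        rw [sub_eq_zero] at hzr
        exact hpz (hzr ▸ hr0)
      have : 1 - z * (1 / (z - r)) = -r * (1 / (z - r)) := by field_simp; ring
      rw [this, Complex.normSq_mul, Complex.normSq_neg]
      refine lt_mul_of_one_lt_left (Complex.normSq_pos.2 (one_div_ne_zero hzr)) ?_
      rw [Complex.normSq_eq_norm_sq]
      exact one_lt_pow₀ hr1 two_ne_zero
    · simp)
  rw [hcard, hsum] at key
  -- With σ = p'(z)/p(z), a vanishing polar derivative says n - zσ = -ξσ, which has modulus at most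
  -- |σ|, against `key`.
  have : (n : ℂ) - z * (p.derivative.eval z / p.eval z) =
      -ξ * (p.derivative.eval z / p.eval z) := by
    field_simp
    linear_combination h0
  rw [this, Complex.normSq_mul, Complex.normSq_neg] at key
  refine absurd key (not_lt.2 (mul_le_of_le_one_left (Complex.normSq_nonneg _) ?_))
  rw [Complex.normSq_eq_norm_sq]
  exact pow_le_one₀ (norm_nonneg _) hξ

/-! ### Stability of keys under polar derivatives -/

/-- The key `∑ (d choose j) c_j z^j` of a single sequence of activities. -/
noncomputable def keyValue (d : ℕ) (c : ℕ → ℂ) (z : ℂ) : ℂ :=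
  ∑ j ∈ Finset.range (d + 1), (d.choose j : ℂ) * c j * z ^ j

/-- Nonvanishing of the key on the closed unit disc. -/
def IsDiscStable (d : ℕ) (c : ℕ → ℂ) : Prop :=
  ∀ z : ℂ, ‖z‖ ≤ 1 → keyValue d c z ≠ 0

/-- Pascal's rule. One of the d + 1 slots of the polarized key is singled out; putting ξ there
instead of z gives the polar derivative. -/
theorem keyValue_succ (d : ℕ) (c : ℕ → ℂ) (z : ℂ) :
    keyValue (d + 1) c z = keyValue d (fun j => c j + z * c (j + 1)) z := by
  have h1 : keyValue d (fun j => c j + z * c (j + 1)) z =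
      keyValue d c z +
        ∑ j ∈ Finset.range (d + 1), (d.choose j : ℂ) * c (j + 1) * z ^ (j + 1) := by
    simp only [keyValue, ← Finset.sum_add_distrib]
    exact Finset.sum_congr rfl fun j _ => by ring
  have h2 : keyValue d c z = c 0 +
      ∑ j ∈ Finset.range (d + 1), (d.choose (j + 1) : ℂ) * c (j + 1) * z ^ (j + 1) := by
    rw [Finset.sum_range_succ, keyValue, Finset.sum_range_succ']
    simp [add_comm]
  rw [h1, h2, keyValue, Finset.sum_range_succ', add_assoc, ← Finset.sum_add_distrib, add_comm]
  congr 1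
  · simp
  · refine Finset.sum_congr rfl fun j _ => ?_
    rw [Nat.choose_succ_succ]; push_cast; ring

/-- If p is the key of degree d + 1, the new key is the polar derivative (d+1) p + (ξ - z) p'
divided by d + 1. -/
theorem IsDiscStable.polar {d : ℕ} {c : ℕ → ℂ} (h : IsDiscStable (d + 1) c) {ξ : ℂ}
    (hξ : ‖ξ‖ ≤ 1) : IsDiscStable d fun j => c j + ξ * c (j + 1) := by
  intro z hz h0
  set p : ℂ[X] := ∑ j ∈ Finset.range (d + 2), C (((d + 1).choose j : ℂ) * c j) * X ^ j with hp
  have heval : ∀ y, p.eval y = keyValue (d + 1) c y := by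
    intro y
    simp [hp, eval_finsetSum, keyValue]
  have hdeg : p.natDegree ≤ d + 1 := by
    refine natDegree_sum_le_of_forall_le _ _ fun j hj => ?_
    exact (natDegree_C_mul_X_pow_le _ _).trans (by simpa [Nat.lt_succ_iff] using hj)
  have hder : p.derivative.eval z =
      (d + 1) * ∑ j ∈ Finset.range (d + 1), (d.choose j : ℂ) * c (j + 1) * z ^ j := by
    rw [hp, derivative_sum, eval_finsetSum, Finset.sum_range_succ', Finset.mul_sum]
    simp only [derivative_C_mul_X_pow, eval_mul, eval_C, eval_pow, eval_X]
    rw [Nat.cast_zero, mul_zero, zero_mul, add_zero]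
    refine Finset.sum_congr rfl fun j _ => ?_
    have := congrArg (Nat.cast (R := ℂ)) (Nat.add_one_mul_choose_eq d j)
    push_cast at this ⊢
    linear_combination -(c (j + 1) * z ^ j) * this
  refine laguerre_ne_zero (Nat.succ_ne_zero d) hdeg (fun y hy => heval y ▸ h y hy) hz hξ ?_
  rw [hder, heval, keyValue_succ]
  have h1 : ∀ ζ, keyValue d (fun j => c j + ζ * c (j + 1)) z =
      keyValue d c z +
        ζ * ∑ j ∈ Finset.range (d + 1), (d.choose j : ℂ) * c (j + 1) * z ^ j := by
    intro ζ
    simp only [keyValue, Finset.mul_sum, ← Finset.sum_add_distrib]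
    exact Finset.sum_congr rfl fun j _ => by ring
  rw [h1] at h0 ⊢
  push_cast
  linear_combination (d + 1 : ℂ) * h0

/-- A quadratic without zeros in the closed unit disc has dominant constant coefficient. -/
theorem norm_lt_of_quadratic_ne_zero {a b d : ℂ}
    (h : ∀ z : ℂ, ‖z‖ ≤ 1 → a + b * z + d * z ^ 2 ≠ 0) : ‖d‖ < ‖a‖ := by
  rcases eq_or_ne d 0 with rfl | hd
  · have := h 0 (by simp)
    simpa using this
  obtain ⟨r, hr⟩ : ∃ r : ℂ, a + b * r + d * r ^ 2 = 0 := by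
    obtain ⟨r, hr⟩ := IsAlgClosed.exists_root (C d * X ^ 2 + C b * X + C a)
      (by rw [degree_quadratic hd]; decide)
    refine ⟨r, ?_⟩
    simp only [IsRoot.def, eval_add, eval_mul, eval_C, eval_pow, eval_X] at hr
    linear_combination hr
  have hr1 : 1 < ‖r‖ := by
    by_contra hle
    exact h r (not_lt.1 hle) hr
  set s : ℂ := -b / d - r with hs
  have hb : b = -d * (r + s) := by rw [hs]; field_simp; ring
  have ha : a = d * (r * s) := by rw [hb] at hr; linear_combination hr
  have hs1 : 1 < ‖s‖ := by
    by_contra hle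
    exact h s (not_lt.1 hle) (by rw [ha, hb]; ring)
  rw [ha, norm_mul, norm_mul]
  exact lt_mul_of_one_lt_right (norm_pos_iff.2 hd) (one_lt_mul_of_lt_of_le hr1 hs1.le)

end SubgraphZeros

/-! ### Nonvanishing for multigraphs with chosen edge ends -/

namespace SubgraphZeros

variable {α β : Type*}

theorem keyValue_mul_pow (d : ℕ) (c : ℕ → ℂ) (x z : ℂ) :
    keyValue d (fun j => c j * x ^ j) z = keyValue d c (x * z) :=
  Finset.sum_congr rfl fun j _ => by rw [mul_pow]; ring

theorem keyValue_reverse {d : ℕ} {c : ℕ → ℂ} {z : ℂ} (hz : z ≠ 0) :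
    keyValue d (fun j => c (d - j)) z = z ^ d * keyValue d c z⁻¹ := by
  rw [keyValue, ← Finset.sum_range_reflect, keyValue, Finset.mul_sum]
  refine Finset.sum_congr rfl fun j hj => ?_
  obtain ⟨i, rfl⟩ := Nat.exists_eq_add_of_le (Nat.lt_succ_iff.1 (Finset.mem_range.1 hj))
  have h1 : j + i + 1 - 1 - j = i := by omega
  have h2 : j + i - i = j := by omega
  have h3 : ((j + i).choose i : ℂ) = (j + i).choose j := by rw [Nat.choose_symm_add]
  simp only [h1, h2, h3]
  rw [inv_pow, pow_add]
  field_simp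

theorem keyValue_zero_right (d : ℕ) (c : ℕ → ℂ) : keyValue d c 0 = c 0 := by
  rw [keyValue, Finset.sum_range_succ']
  simp

open Classical in
/-- The degree of `v` in the multigraph with edge set `H` in which `e` joins `a e` to `b e`. -/
noncomputable def endDeg (a b : β → α) (H : Finset β) (v : α) : ℕ :=
  ∑ e ∈ H, ((if a e = v then 1 else 0) + if b e = v then 1 else 0)

/-- The partition function of the multigraph with vertex set `V` and edge set `E`, in which `e`
joins `a e` to `b e`. -/
noncomputable def partitionSum (V : Finset α) (a b : β → α) (lam : β → ℂ) (E : Finset β)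
    (u : α → ℕ → ℂ) : ℂ :=
  ∑ H ∈ E.powerset, (∏ e ∈ H, lam e) * ∏ v ∈ V, u v (endDeg a b H v)

open Classical in
/-- Replace the activities `u_j` at `w` by `u_j + ξ u_{j+1}`. -/
noncomputable def polarAt (w : α) (ξ : ℂ) (u : α → ℕ → ℂ) (v : α) (j : ℕ) : ℂ :=
  if w = v then u v j + ξ * u v (j + 1) else u v j

open Classical in
/-- Replace the activities `u_j` at `w` by `u_{j+1}`. -/
noncomputable def shiftAt (w : α) (u : α → ℕ → ℂ) (v : α) (j : ℕ) : ℂ :=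
  u v (j + if w = v then 1 else 0)

theorem shiftAt_polarAt (w w' : α) (ξ : ℂ) (u : α → ℕ → ℂ) :
    shiftAt w (polarAt w' ξ u) = polarAt w' ξ (shiftAt w u) := by
  funext v j
  simp only [shiftAt, polarAt, add_right_comm]

theorem prod_polarAt {V : Finset α} {w : α} (hw : w ∈ V) (ξ : ℂ) (u : α → ℕ → ℂ) (m : α → ℕ) :
    ∏ v ∈ V, polarAt w ξ u v (m v) =
      ∏ v ∈ V, u v (m v) + ξ * ∏ v ∈ V, shiftAt w u v (m v) := by
  classical
  rw [← Finset.mul_prod_erase V _ hw, ← Finset.mul_prod_erase V (fun v => u v (m v)) hw,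
    ← Finset.mul_prod_erase V (fun v => shiftAt w u v (m v)) hw]
  have h1 : ∏ v ∈ V.erase w, polarAt w ξ u v (m v) = ∏ v ∈ V.erase w, u v (m v) :=
    Finset.prod_congr rfl fun v hv => if_neg (Finset.ne_of_mem_erase hv).symm
  have h2 : ∏ v ∈ V.erase w, shiftAt w u v (m v) = ∏ v ∈ V.erase w, u v (m v) :=
    Finset.prod_congr rfl fun v hv => by
      simp [shiftAt, (Finset.ne_of_mem_erase hv).symm]
  rw [h1, h2]
  simp only [polarAt, shiftAt, if_true]
  ring

theorem partitionSum_polarAt {V : Finset α} {w : α} (hw : w ∈ V) (a b : β → α) (lam : β → ℂ)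
    (E : Finset β) (ξ : ℂ) (u : α → ℕ → ℂ) :
    partitionSum V a b lam E (polarAt w ξ u) =
      partitionSum V a b lam E u + ξ * partitionSum V a b lam E (shiftAt w u) := by
  simp only [partitionSum, prod_polarAt hw, Finset.mul_sum, ← Finset.sum_add_distrib]
  exact Finset.sum_congr rfl fun H _ => by ring

open Classical in
theorem endDeg_insert (a b : β → α) {e : β} {H : Finset β} (he : e ∉ H) (v : α) :
    endDeg a b (insert e H) v =
      (endDeg a b H v + if b e = v then 1 else 0) + if a e = v then 1 else 0 := by
  rw [endDeg, Finset.sum_insert he, endDeg]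
  ring

open Classical in
theorem partitionSum_insert (V : Finset α) (a b : β → α) (lam : β → ℂ) {e : β} {E : Finset β}
    (he : e ∉ E) (u : α → ℕ → ℂ) :
    partitionSum V a b lam (insert e E) u =
      partitionSum V a b lam E u +
        lam e * partitionSum V a b lam E (shiftAt (b e) (shiftAt (a e) u)) := by
  rw [partitionSum, Finset.sum_powerset_insert he, partitionSum, partitionSum, Finset.mul_sum]
  congr 1
  refine Finset.sum_congr rfl fun H hH => ?_
  have heH : e ∉ H := fun h => he (Finset.mem_powerset.1 hH h)
  rw [Finset.prod_insert heH, mul_assoc]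
  simp only [endDeg_insert a b heH, shiftAt]

open Classical in
theorem IsDiscStable.polarAt {w v : α} {n : ℕ} {u : α → ℕ → ℂ} {ξ : ℂ} (hξ : ‖ξ‖ ≤ 1)
    (h : IsDiscStable (n + if w = v then 1 else 0) (u v)) :
    IsDiscStable n (polarAt w ξ u v) := by
  by_cases hwv : w = v
  · rw [if_pos hwv] at h
    have : SubgraphZeros.polarAt w ξ u v = fun j => u v j + ξ * u v (j + 1) :=
      funext fun j => if_pos hwv
    rw [this]
    exact h.polar hξ
  · rw [if_neg hwv] at h
    have : SubgraphZeros.polarAt w ξ u v = u v := funext fun j => if_neg hwv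
    rwa [this]

/-- Induction on the edges with the activities left free, since the induction hypothesis is applied
to polarized activities. -/
theorem partitionSum_ne_zero {V : Finset α} {a b : β → α} {lam : β → ℂ} {E : Finset β}
    (hab : ∀ e ∈ E, a e ∈ V ∧ b e ∈ V) (hlam : ∀ e ∈ E, ‖lam e‖ ≤ 1) {u : α → ℕ → ℂ}
    (hu : ∀ v ∈ V, IsDiscStable (endDeg a b E v) (u v)) :
    partitionSum V a b lam E u ≠ 0 := by
  classical
  induction E using Finset.induction_on generalizing u with
  | empty =>
    have : ∀ v ∈ V, u v 0 ≠ 0 := fun v hv => by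
      simpa [endDeg, keyValue] using hu v hv 0 (by simp)
    simpa [partitionSum, endDeg, Finset.prod_eq_zero_iff] using this
  | insert e E he ih =>
    obtain ⟨hae, hbe⟩ := hab e (Finset.mem_insert_self _ _)
    have hE : ∀ {f}, f ∈ E → f ∈ insert e E := Finset.mem_insert_of_mem
    have key : ‖partitionSum V a b lam E (shiftAt (b e) (shiftAt (a e) u))‖ <
        ‖partitionSum V a b lam E u‖ := by
      refine norm_lt_of_quadratic_ne_zero (b := partitionSum V a b lam E (shiftAt (a e) u) +
        partitionSum V a b lam E (shiftAt (b e) u)) fun ξ hξ => ?_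
      have hne := ih (fun f hf => hab f (hE hf)) (fun f hf => hlam f (hE hf))
        -- Each polar derivative spends one unit of degree at an end of `e`; a loop spends both at
        -- the same vertex, so it needs no separate case.
        (u := polarAt (b e) ξ (polarAt (a e) ξ u)) fun v hv => by
          refine IsDiscStable.polarAt hξ (IsDiscStable.polarAt hξ ?_)
          rw [← endDeg_insert a b he]
          exact hu v hv
      rw [partitionSum_polarAt hbe, shiftAt_polarAt, partitionSum_polarAt hae,
        partitionSum_polarAt hae] at hne
      have hcomm : shiftAt (a e) (shiftAt (b e) u) = shiftAt (b e) (shiftAt (a e) u) := by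
        funext v j
        simp only [shiftAt, add_right_comm]
      rw [hcomm] at hne
      convert hne using 1
      ring
    rw [partitionSum_insert V a b lam he]
    intro h0
    have h1 := congrArg norm (eq_neg_of_add_eq_zero_left h0)
    rw [norm_neg, norm_mul] at h1
    have h2 := mul_le_of_le_one_left
      (norm_nonneg (partitionSum V a b lam E (shiftAt (b e) (shiftAt (a e) u))))
      (hlam e (Finset.mem_insert_self _ _))
    linarith

/-- Nonvanishing of the partition function inside the disc of radius `r`. -/
theorem partitionSum_ne_zero_of_lt {V : Finset α} {a b : β → α} {lam : β → ℂ} {E : Finset β}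
    (hab : ∀ e ∈ E, a e ∈ V ∧ b e ∈ V) (hlam : ∀ e ∈ E, ‖lam e‖ = 1) {u : α → ℕ → ℂ} {r : ℝ}
    (hu : ∀ v ∈ V, ∀ z : ℂ, ‖z‖ < r → keyValue (endDeg a b E v) (u v) z ≠ 0)
    {x : α → ℂ} (hx : ∀ v ∈ V, ‖x v‖ < r) :
    partitionSum V a b lam E (fun v j => u v j * x v ^ j) ≠ 0 := by
  refine partitionSum_ne_zero hab (fun e he => (hlam e he).le) fun v hv z hz => ?_
  rw [keyValue_mul_pow]
  -- The rescaled key at z is the old key at x_v z, and |x_v| < r keeps x_v z in the open disc even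
  -- for |z| = 1.
  refine hu v hv _ ?_
  rw [norm_mul]
  exact (mul_le_of_le_one_right (norm_nonneg _) hz).trans_lt (hx v hv)

theorem endDeg_mono (a b : β → α) {H E : Finset β} (h : H ⊆ E) (v : α) :
    endDeg a b H v ≤ endDeg a b E v :=
  Finset.sum_le_sum_of_subset h

open Classical in
theorem endDeg_sdiff (a b : β → α) {H E : Finset β} (h : H ⊆ E) (v : α) :
    endDeg a b (E \ H) v = endDeg a b E v - endDeg a b H v := by
  have : endDeg a b (E \ H) v + endDeg a b H v = endDeg a b E v := Finset.sum_sdiff h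
  omega

/-- Complementation of edge sets. -/
theorem partitionSum_reverse {V : Finset α} {a b : β → α} {lam : β → ℂ} {E : Finset β}
    (hlam : ∀ e ∈ E, lam e ≠ 0) (u : α → ℕ → ℂ) :
    partitionSum V a b lam E u = (∏ e ∈ E, lam e) *
      partitionSum V a b (fun e => (lam e)⁻¹) E (fun v j => u v (endDeg a b E v - j)) := by
  classical
  rw [partitionSum, partitionSum, Finset.mul_sum]
  refine Finset.sum_nbij' (fun H => E \ H) (fun H => E \ H)
    (fun H _ => Finset.mem_powerset.2 Finset.sdiff_subset)
    (fun H _ => Finset.mem_powerset.2 Finset.sdiff_subset)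
    (fun H hH => Finset.sdiff_sdiff_eq_self (Finset.mem_powerset.1 hH))
    (fun H hH => Finset.sdiff_sdiff_eq_self (Finset.mem_powerset.1 hH)) fun H hH => ?_
  rw [Finset.mem_powerset] at hH
  have h1 : (∏ e ∈ E, lam e) * ∏ e ∈ E \ H, (lam e)⁻¹ = ∏ e ∈ H, lam e := by
    rw [← Finset.prod_sdiff hH, Finset.prod_inv_distrib, mul_comm, ← mul_assoc, inv_mul_cancel₀,
      one_mul]
    exact Finset.prod_ne_zero_iff.2 fun e he => hlam e (Finset.sdiff_subset he)
  have h2 : ∀ v, endDeg a b E v - endDeg a b (E \ H) v = endDeg a b H v := fun v => by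
    rw [endDeg_sdiff a b hH]
    have := endDeg_mono a b hH v
    omega
  rw [← mul_assoc, h1]
  simp only [h2]

/-- Nonvanishing of the partition function outside the disc of radius `r`. -/
theorem partitionSum_ne_zero_of_gt {V : Finset α} {a b : β → α} {lam : β → ℂ} {E : Finset β}
    (hab : ∀ e ∈ E, a e ∈ V ∧ b e ∈ V) (hlam : ∀ e ∈ E, ‖lam e‖ = 1) {u : α → ℕ → ℂ} {r : ℝ}
    (hr : 0 ≤ r) (hu0 : ∀ v ∈ V, u v (endDeg a b E v) ≠ 0)
    (hu : ∀ v ∈ V, ∀ z : ℂ, r < ‖z‖ → keyValue (endDeg a b E v) (u v) z ≠ 0)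
    {x : α → ℂ} (hx : ∀ v ∈ V, r < ‖x v‖) :
    partitionSum V a b lam E (fun v j => u v j * x v ^ j) ≠ 0 := by
  have hlam0 : ∀ e ∈ E, lam e ≠ 0 := fun e he => norm_ne_zero_iff.1 (by rw [hlam e he]; simp)
  rw [partitionSum_reverse hlam0]
  refine mul_ne_zero (Finset.prod_ne_zero_iff.2 hlam0)
    (partitionSum_ne_zero hab (fun e he => by simp [hlam e he]) fun v hv z hz => ?_)
  have hxv : x v ≠ 0 := norm_pos_iff.1 (hr.trans_lt (hx v hv))
  -- At z = 0 the reversed key equals its top activity times a power of x_v, so the full degree of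
  -- the key is needed here.
  rcases eq_or_ne z 0 with rfl | hz0
  · rw [keyValue_zero_right]
    exact mul_ne_zero (hu0 v hv) (pow_ne_zero _ hxv)
  · have := keyValue_reverse (d := endDeg a b E v) (c := fun j => u v j * x v ^ j) hz0
    rw [this, keyValue_mul_pow]
    refine mul_ne_zero (pow_ne_zero _ hz0) (hu v hv _ ?_)
    rw [norm_mul, norm_inv]
    exact (hx v hv).trans_le (le_mul_of_one_le_right (norm_nonneg _)
      ((one_le_inv₀ (norm_pos_iff.2 hz0)).2 hz))

end SubgraphZeros

/-! ### Transfer to `Graph` and to the diagonal -/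

namespace SubgraphZeros

variable {α β : Type*}

/-- The ends are total functions on `β`, so a default vertex is needed off the edge set; an empty
vertex type is treated separately. -/
theorem exists_ends [Nonempty α] (G : Graph α β) :
    ∃ a b : β → α, ∀ e ∈ G.edgeSet, G.IsLink e (a e) (b e) := by
  have h : ∀ e, ∃ p : α × α, e ∈ G.edgeSet → G.IsLink e p.1 p.2 := fun e => by
    by_cases he : e ∈ G.edgeSet
    · obtain ⟨x, y, hxy⟩ := G.exists_isLink_of_mem_edgeSet he
      exact ⟨(x, y), fun _ => hxy⟩
    · exact ⟨Classical.arbitrary _, fun h => absurd h he⟩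
  choose p hp using h
  exact ⟨fun e => (p e).1, fun e => (p e).2, hp⟩

theorem edgeSet_eq_empty_of_isEmpty [IsEmpty α] (G : Graph α β) : G.edgeSet = ∅ := by
  refine Set.eq_empty_of_forall_notMem fun e he => ?_
  obtain ⟨x, -⟩ := G.exists_isLink_of_mem_edgeSet he
  exact isEmptyElim x

/-- A loop is counted once as an incidence and once as a loop, which matches its two coinciding
ends. -/
theorem deg_eq_endDeg {G : Graph α β} {a b : β → α}
    (hab : ∀ e ∈ G.edgeSet, G.IsLink e (a e) (b e)) {H : Finset β}
    (hH : (H : Set β) ⊆ G.edgeSet) (v : α) : deg G (H : Set β) v = endDeg a b H v := by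
  classical
  have h1 : {e | e ∈ (H : Set β) ∧ G.Inc e v} = (H.filter fun e => G.Inc e v : Finset β) := by
    ext e; simp
  have h2 : {e | e ∈ (H : Set β) ∧ G.IsLoopAt e v} =
      (H.filter fun e => G.IsLoopAt e v : Finset β) := by
    ext e; simp
  rw [deg, h1, h2, Set.ncard_coe_finset, Set.ncard_coe_finset, Finset.card_filter,
    Finset.card_filter, ← Finset.sum_add_distrib, endDeg]
  refine Finset.sum_congr rfl fun e he => ?_
  have hl := hab e (hH he)
  have hi : G.Inc e v ↔ a e = v ∨ b e = v :=
    ⟨fun h => (h.eq_or_eq_of_isLink hl).imp Eq.symm Eq.symm,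
      fun h => h.elim (fun h => h ▸ hl.inc_left) fun h => h ▸ hl.inc_right⟩
  have hloop : G.IsLoopAt e v ↔ a e = v ∧ b e = v := by
    rw [← Graph.isLink_self_iff, hl.isLink_iff]
    tauto
  simp only [hi, hloop]
  by_cases ha : a e = v <;> by_cases hb : b e = v <;> simp [ha, hb]

theorem eval_partitionPoly (G : Graph α β) (hV : G.vertexSet.Finite) (hE : G.edgeSet.Finite)
    (lam : β → ℂ) (u : α → ℕ → ℂ) (x : α → ℂ) :
    MvPolynomial.eval x (partitionPoly G hV hE lam u) =
      ∑ H ∈ hE.toFinset.powerset, (∏ e ∈ H, lam e) *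
        ∏ v ∈ hV.toFinset, u v (deg G (H : Set β) v) * x v ^ deg G (H : Set β) v := by
  simp only [partitionPoly, map_sum, map_mul, MvPolynomial.eval_C, map_prod, map_pow,
    MvPolynomial.eval_X, Finset.prod_mul_distrib, mul_assoc]

theorem coe_subset_edgeSet {G : Graph α β} {hE : G.edgeSet.Finite} {H : Finset β}
    (hH : H ∈ hE.toFinset.powerset) : (H : Set β) ⊆ G.edgeSet := fun e he => by
  simpa using Finset.mem_powerset.1 hH he

theorem eval_partitionPoly_eq_partitionSum {G : Graph α β} (hV : G.vertexSet.Finite)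
    (hE : G.edgeSet.Finite) {a b : β → α} (hab : ∀ e ∈ G.edgeSet, G.IsLink e (a e) (b e))
    (lam : β → ℂ) (u : α → ℕ → ℂ) (x : α → ℂ) :
    MvPolynomial.eval x (partitionPoly G hV hE lam u) =
      partitionSum hV.toFinset a b lam hE.toFinset fun v j => u v j * x v ^ j := by
  rw [eval_partitionPoly, partitionSum]
  refine Finset.sum_congr rfl fun H hH => ?_
  simp only [deg_eq_endDeg hab (coe_subset_edgeSet hH)]

theorem eval_partitionPoly_of_isEmpty [IsEmpty α] (G : Graph α β) (hV : G.vertexSet.Finite)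
    (hE : G.edgeSet.Finite) (lam : β → ℂ) (u : α → ℕ → ℂ) (x : α → ℂ) :
    MvPolynomial.eval x (partitionPoly G hV hE lam u) = 1 := by
  have h1 : hV.toFinset = ∅ := Finset.eq_empty_of_isEmpty _
  have h2 : hE.toFinset = ∅ := by simpa using edgeSet_eq_empty_of_isEmpty G
  rw [eval_partitionPoly, h1, h2]
  simp

/-- The handshake identity. -/
theorem sum_deg_eq {G : Graph α β} (hV : G.vertexSet.Finite) {H : Finset β}
    (hH : (H : Set β) ⊆ G.edgeSet) : ∑ v ∈ hV.toFinset, deg G (H : Set β) v = 2 * H.card := by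
  classical
  rcases isEmpty_or_nonempty α with hα | hα
  · rw [edgeSet_eq_empty_of_isEmpty, Set.subset_empty_iff, Finset.coe_eq_empty] at hH
    have h1 : hV.toFinset = ∅ := Finset.eq_empty_of_isEmpty _
    simp [hH, h1]
  · obtain ⟨a, b, hab⟩ := exists_ends G
    simp only [deg_eq_endDeg hab hH, endDeg]
    rw [Finset.sum_comm, mul_comm, ← smul_eq_mul, ← Finset.sum_const]
    refine Finset.sum_congr rfl fun e he => ?_
    have hl := hab e (hH he)
    simp [Finset.sum_add_distrib, hl.left_mem, hl.right_mem]

theorem deg_mono {G : Graph α β} (hE : G.edgeSet.Finite) {H : Set β} (hH : H ⊆ G.edgeSet)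
    (v : α) : deg G H v ≤ deg G G.edgeSet v :=
  add_le_add
    (Set.ncard_le_ncard (fun _ he => ⟨hH he.1, he.2⟩) (hE.subset fun _ he => he.1))
    (Set.ncard_le_ncard (fun _ he => ⟨hH he.1, he.2⟩) (hE.subset fun _ he => he.1))

theorem eval_partitionPoly_const {G : Graph α β} (hV : G.vertexSet.Finite)
    (hE : G.edgeSet.Finite) (lam : β → ℂ) (u : α → ℕ → ℂ) (s : ℂ) :
    MvPolynomial.eval (fun _ => s) (partitionPoly G hV hE lam u) =
      ∑ H ∈ hE.toFinset.powerset,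
        ((∏ e ∈ H, lam e) * ∏ v ∈ hV.toFinset, u v (deg G (H : Set β) v)) *
          (s ^ 2) ^ H.card := by
  rw [eval_partitionPoly]
  refine Finset.sum_congr rfl fun H hH => ?_
  rw [Finset.prod_mul_distrib, Finset.prod_pow_eq_pow_sum,
    sum_deg_eq hV (coe_subset_edgeSet hH), pow_mul, mul_assoc]

theorem exists_isSqrtDiagonal {G : Graph α β} (hV : G.vertexSet.Finite)
    (hE : G.edgeSet.Finite) (lam : β → ℂ) (u : α → ℕ → ℂ) :
    ∃ P : ℂ[X], IsSqrtDiagonal (partitionPoly G hV hE lam u) P := by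
  refine ⟨∑ H ∈ hE.toFinset.powerset,
    C ((∏ e ∈ H, lam e) * ∏ v ∈ hV.toFinset, u v (deg G (H : Set β) v)) * X ^ H.card, ?_⟩
  rintro y s rfl
  rw [eval_partitionPoly_const, eval_finsetSum]
  simp only [eval_mul, eval_C, eval_pow, eval_X]

theorem eval_keyPoly (G : Graph α β) (u : α → ℕ → ℂ) (v : α) (z : ℂ) :
    (keyPoly G u v).eval z = keyValue (deg G G.edgeSet v) (u v) z := by
  rw [keyPoly, eval_finsetSum, keyValue]
  simp only [eval_mul, eval_C, eval_pow, eval_X]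

theorem coeff_keyPoly (G : Graph α β) (u : α → ℕ → ℂ) (v : α) {j : ℕ}
    (hj : j ≤ deg G G.edgeSet v) :
    (keyPoly G u v).coeff j = (deg G G.edgeSet v).choose j * u v j := by
  rw [keyPoly, finsetSum_coeff]
  simp only [coeff_C_mul_X_pow]
  rw [Finset.sum_ite_eq, if_pos (Finset.mem_range.2 (Nat.lt_succ_iff.2 hj))]

/-- Keys of full degree with all zeros on the circle of radius `r`. -/
theorem zeros_of_keys_on_circle {G : Graph α β} (hV : G.vertexSet.Finite)
    (hE : G.edgeSet.Finite) {lam : β → ℂ} {u : α → ℕ → ℂ} {r : ℝ} (hr : 0 ≤ r)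
    (hlam : ∀ e ∈ G.edgeSet, ‖lam e‖ = 1)
    (hkey : ∀ v ∈ G.vertexSet,
      (keyPoly G u v).degree = (deg G G.edgeSet v : WithBot ℕ) ∧
      ∀ z : ℂ, (keyPoly G u v).IsRoot z → ‖z‖ = r) :
    (∀ x : α → ℂ, (∀ v ∈ G.vertexSet, ‖x v‖ < r) →
      MvPolynomial.eval x (partitionPoly G hV hE lam u) ≠ 0) ∧
    (∀ x : α → ℂ, (∀ v ∈ G.vertexSet, r < ‖x v‖) →
      MvPolynomial.eval x (partitionPoly G hV hE lam u) ≠ 0) ∧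
    ∃ P : ℂ[X], IsSqrtDiagonal (partitionPoly G hV hE lam u) P ∧
      ∀ y : ℂ, P.IsRoot y → ‖y‖ = r ^ 2 := by
  have hinout : (∀ x : α → ℂ, (∀ v ∈ G.vertexSet, ‖x v‖ < r) →
      MvPolynomial.eval x (partitionPoly G hV hE lam u) ≠ 0) ∧
      (∀ x : α → ℂ, (∀ v ∈ G.vertexSet, r < ‖x v‖) →
      MvPolynomial.eval x (partitionPoly G hV hE lam u) ≠ 0) := by
    rcases isEmpty_or_nonempty α with hα | hα
    · simp [eval_partitionPoly_of_isEmpty]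
    obtain ⟨a, b, hab⟩ := exists_ends G
    have hab' : ∀ e ∈ hE.toFinset, a e ∈ hV.toFinset ∧ b e ∈ hV.toFinset := fun e he => by
      have hl := hab e (by simpa using he)
      simpa using ⟨hl.left_mem, hl.right_mem⟩
    have hlam' : ∀ e ∈ hE.toFinset, ‖lam e‖ = 1 := fun e he => hlam e (by simpa using he)
    have hdeg : ∀ v, deg G G.edgeSet v = endDeg a b hE.toFinset v := fun v => by
      rw [← deg_eq_endDeg hab (by simp), Set.Finite.coe_toFinset]
    have hroot : ∀ v ∈ hV.toFinset, ∀ z : ℂ, ‖z‖ ≠ r →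
        keyValue (endDeg a b hE.toFinset v) (u v) z ≠ 0 := fun v hv z hz h0 => by
      rw [← hdeg, ← eval_keyPoly] at h0
      exact hz ((hkey v (by simpa using hv)).2 z h0)
    refine ⟨fun x hx => ?_, fun x hx => ?_⟩
    · rw [eval_partitionPoly_eq_partitionSum hV hE hab]
      exact partitionSum_ne_zero_of_lt hab' hlam' (fun v hv z hz => hroot v hv z hz.ne)
        fun v hv => hx v (by simpa using hv)
    · rw [eval_partitionPoly_eq_partitionSum hV hE hab]
      refine partitionSum_ne_zero_of_gt hab' hlam' hr (fun v hv => ?_)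
        (fun v hv z hz => hroot v hv z hz.ne') fun v hv => hx v (by simpa using hv)
      -- The leading coefficient of the key is a nonzero multiple of the top activity.
      have h1 := coeff_ne_zero_of_eq_degree (hkey v (by simpa using hv)).1
      rw [coeff_keyPoly G u v le_rfl] at h1
      rw [← hdeg]
      exact right_ne_zero_of_mul h1
  refine ⟨hinout.1, hinout.2, ?_⟩
  obtain ⟨P, hP⟩ := exists_isSqrtDiagonal hV hE lam u
  refine ⟨P, hP, fun y hy => ?_⟩
  obtain ⟨s, hs⟩ := IsAlgClosed.exists_pow_nat_eq y two_pos
  have h0 : MvPolynomial.eval (fun _ => s) (partitionPoly G hV hE lam u) = 0 :=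
    (hP y s hs).symm.trans hy
  have hsr : ‖s‖ = r := by
    rcases lt_trichotomy ‖s‖ r with h | h | h
    · exact absurd h0 (hinout.1 _ fun _ _ => h)
    · exact h
    · exact absurd h0 (hinout.2 _ fun _ _ => h)
  rw [← hs, norm_pow, hsr]

/-! ### The special keys -/

theorem norm_eq_one_of_geom_sum_eq_zero {n : ℕ} {z : ℂ}
    (h : ∑ j ∈ Finset.range (n + 1), z ^ j = 0) : ‖z‖ = 1 := by
  have h1 := geom_sum_mul z (n + 1)
  rw [h, zero_mul] at h1
  exact Complex.norm_eq_one_of_pow_eq_one (sub_eq_zero.1 h1.symm) n.succ_ne_zero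

theorem geom_key_on_circle {G : Graph α β} {u : α → ℕ → ℂ} {v : α}
    (h : keyPoly G u v = ∑ j ∈ Finset.range (deg G G.edgeSet v + 1), X ^ j) :
    (keyPoly G u v).degree = (deg G G.edgeSet v : WithBot ℕ) ∧
      ∀ z : ℂ, (keyPoly G u v).IsRoot z → ‖z‖ = 1 := by
  rw [h]
  constructor
  · refine degree_eq_of_le_of_coeff_ne_zero ?_ ?_
    · refine (degree_sum_le _ _).trans (Finset.sup_le fun j hj => ?_)
      rw [degree_X_pow]
      exact_mod_cast Nat.lt_succ_iff.1 (Finset.mem_range.1 hj)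
    · simp [finsetSum_coeff, coeff_X_pow]
  · intro z hz
    rw [IsRoot.def, eval_finsetSum] at hz
    simp only [eval_pow, eval_X] at hz
    exact norm_eq_one_of_geom_sum_eq_zero hz

theorem eval_partitionPoly_eq_binomialSum {G : Graph α β} (hV : G.vertexSet.Finite)
    (hE : G.edgeSet.Finite) {u : α → ℕ → ℂ}
    (h : ∀ v ∈ G.vertexSet, keyPoly G u v = ∑ j ∈ Finset.range (deg G G.edgeSet v + 1), X ^ j)
    (s : ℂ) :
    MvPolynomial.eval (fun _ => s) (partitionPoly G hV hE (fun _ => 1) u) =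
      binomialSum G hV hE (s ^ 2) := by
  rw [eval_partitionPoly_const, binomialSum]
  refine Finset.sum_congr rfl fun H hH => ?_
  rw [Finset.prod_const_one, one_mul, mul_comm, div_eq_mul_inv, ← Finset.prod_inv_distrib]
  congr 1
  refine Finset.prod_congr rfl fun v hv => ?_
  have hle := deg_mono hE (coe_subset_edgeSet hH) v
  have h1 := coeff_keyPoly G u v hle
  rw [h v (by simpa using hv)] at h1
  simp only [finsetSum_coeff, coeff_X_pow] at h1
  rw [Finset.sum_ite_eq, if_pos (Finset.mem_range.2 (Nat.lt_succ_iff.2 hle))] at h1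
  exact eq_inv_of_mul_eq_one_right h1.symm

theorem keyPoly_inv_choose (G : Graph α β) (v : α) :
    keyPoly G (fun v j => ((deg G G.edgeSet v).choose j : ℂ)⁻¹) v =
      ∑ j ∈ Finset.range (deg G G.edgeSet v + 1), X ^ j := by
  rw [keyPoly]
  refine Finset.sum_congr rfl fun j hj => ?_
  have : ((deg G G.edgeSet v).choose j : ℂ) ≠ 0 := by
    exact_mod_cast (Nat.choose_pos (Nat.lt_succ_iff.1 (Finset.mem_range.1 hj))).ne'
  rw [mul_inv_cancel₀ this, C_1, one_mul]

/-- Zeros of a real quadratic with nonpositive discriminant. -/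
theorem mul_normSq_eq_one_of_quadratic {b t : ℝ} (hbt : b ^ 2 ≤ 4 * t) {w : ℂ}
    (h : 1 + (b : ℂ) * w + (t : ℂ) * w ^ 2 = 0) : t * Complex.normSq w = 1 := by
  obtain ⟨p, q⟩ := w
  have hre := congrArg Complex.re h
  have him := congrArg Complex.im h
  simp only [pow_two, Complex.add_re, Complex.add_im, Complex.mul_re, Complex.mul_im,
    Complex.ofReal_re, Complex.ofReal_im, Complex.one_re, Complex.one_im, Complex.zero_re,
    Complex.zero_im] at hre him
  -- A nonreal zero has real part -b/(2t), from the imaginary part of the equation. For a real zero,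
  -- (2tp + b)² = b² - 4t ≤ 0 forces a double zero.
  have key : b * p = -2 * t * p ^ 2 := by
    rcases eq_or_ne q 0 with rfl | hq
    · have h1 : (2 * t * p + b) ^ 2 = 0 :=
        le_antisymm (by nlinarith) (sq_nonneg _)
      have h2 := pow_eq_zero_iff two_ne_zero |>.1 h1
      linear_combination p * h2
    · have h2 : q * (2 * t * p + b) = 0 := by linear_combination him
      have h3 := (mul_eq_zero.1 h2).resolve_left hq
      linear_combination p * h3
  rw [Complex.normSq_apply]
  linear_combination -hre + key

theorem norm_eq_rpow_of_trinomial {k : ℕ} (hk : 1 ≤ k) {b t : ℝ} (ht : 0 < t)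
    (hbt : b ^ 2 ≤ 4 * t) {z : ℂ}
    (h : 1 + (b : ℂ) * z ^ k + (t : ℂ) * z ^ (2 * k) = 0) :
    ‖z‖ = t ^ (-1 / (2 * (k : ℝ))) := by
  rw [mul_comm 2 k, pow_mul] at h
  have h1 := mul_normSq_eq_one_of_quadratic hbt h
  rw [Complex.normSq_eq_norm_sq, norm_pow, ← pow_mul] at h1
  have hk' : k * 2 ≠ 0 := by omega
  have hk0 : (k : ℝ) ≠ 0 := by exact_mod_cast (by omega : k ≠ 0)
  refine (pow_left_inj₀ (norm_nonneg _) (Real.rpow_nonneg ht.le _) hk').1 ?_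
  rw [← Real.rpow_natCast (t ^ (-1 / (2 * (k : ℝ)))), ← Real.rpow_mul ht.le]
  have : -1 / (2 * (k : ℝ)) * ((k * 2 : ℕ) : ℝ) = -1 := by push_cast; field_simp
  rw [this, Real.rpow_neg_one]
  exact eq_inv_of_mul_eq_one_right h1

theorem degree_trinomial_key {k : ℕ} (hk : 1 ≤ k) (b : ℂ) {t : ℂ} (ht : t ≠ 0) :
    (1 + C b * X ^ k + C t * X ^ (2 * k) : ℂ[X]).degree = ((2 * k : ℕ) : WithBot ℕ) := by
  have h1 : (C t * X ^ (2 * k) : ℂ[X]).degree = ((2 * k : ℕ) : WithBot ℕ) :=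
    degree_C_mul_X_pow _ ht
  rw [degree_add_eq_right_of_degree_lt, h1]
  rw [h1]
  refine (degree_add_le _ _).trans_lt (max_lt ?_ ?_)
  · refine degree_one_le.trans_lt ?_
    exact_mod_cast (by omega : 0 < 2 * k)
  · refine (degree_C_mul_X_pow_le _ _).trans_lt ?_
    exact_mod_cast (by omega : k < 2 * k)

end SubgraphZeros
theorem mainTheorem8 {α β : Type*} (G : Graph α β)
    (hV : G.vertexSet.Finite) (hE : G.edgeSet.Finite) :
    -- unit-modulus edge weights, full-degree keys with all zeros on the unit circle
    (∀ (lam : β → ℂ) (u : α → ℕ → ℂ),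
      (∀ e ∈ G.edgeSet, ‖lam e‖ = 1) →
      (∀ v ∈ G.vertexSet,
        (SubgraphZeros.keyPoly G u v).degree = (SubgraphZeros.deg G G.edgeSet v : WithBot ℕ) ∧
        ∀ z : ℂ, (SubgraphZeros.keyPoly G u v).IsRoot z → ‖z‖ = 1) →
      (∀ x : α → ℂ, (∀ v ∈ G.vertexSet, ‖x v‖ < 1) →
        MvPolynomial.eval x (SubgraphZeros.partitionPoly G hV hE lam u) ≠ 0) ∧
      (∀ x : α → ℂ, (∀ v ∈ G.vertexSet, 1 < ‖x v‖) →
        MvPolynomial.eval x (SubgraphZeros.partitionPoly G hV hE lam u) ≠ 0) ∧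
      ∃ P : ℂ[X],
        SubgraphZeros.IsSqrtDiagonal (SubgraphZeros.partitionPoly G hV hE lam u) P ∧
        ∀ y : ℂ, P.IsRoot y → ‖y‖ = 1) ∧
    -- the keys `1 + z + ⋯ + z ^ deg(G,v)` satisfy the hypotheses, and for unit edge weights
    -- they turn `Z(G,1,u;y^{1/2}1)` into the binomial sum
    (∀ u : α → ℕ → ℂ,
      (∀ v ∈ G.vertexSet, SubgraphZeros.keyPoly G u v =
        ∑ j ∈ Finset.range (SubgraphZeros.deg G G.edgeSet v + 1), X ^ j) →
      (∀ v ∈ G.vertexSet,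
        (SubgraphZeros.keyPoly G u v).degree = (SubgraphZeros.deg G G.edgeSet v : WithBot ℕ) ∧
        ∀ z : ℂ, (SubgraphZeros.keyPoly G u v).IsRoot z → ‖z‖ = 1) ∧
      ∀ y s : ℂ, s ^ 2 = y →
        MvPolynomial.eval (fun _ => s)
          (SubgraphZeros.partitionPoly G hV hE (fun _ => 1) u) =
            SubgraphZeros.binomialSum G hV hE y) ∧
    -- hence all zeros of the binomial sum have modulus one
    (∀ y : ℂ, SubgraphZeros.binomialSum G hV hE y = 0 → ‖y‖ = 1) ∧
    -- the keys `1 + (2k choose k) z ^ k + t z ^ (2k)` on a `2k`-regular graph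
    (∀ (k : ℕ) (t : ℝ), 1 ≤ k → ((2 * k).choose k : ℝ) ^ 2 ≤ 4 * t →
      (∀ z : ℂ, 1 + ((2 * k).choose k : ℂ) * z ^ k + (t : ℂ) * z ^ (2 * k) = 0 →
        ‖z‖ = t ^ (-1 / (2 * (k : ℝ)))) ∧
      ∀ (lam : β → ℂ) (u : α → ℕ → ℂ),
        (∀ e ∈ G.edgeSet, ‖lam e‖ = 1) →
        (∀ v ∈ G.vertexSet, SubgraphZeros.deg G G.edgeSet v = 2 * k) →
        (∀ v ∈ G.vertexSet, SubgraphZeros.keyPoly G u v =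
          1 + C ((2 * k).choose k : ℂ) * X ^ k + C (t : ℂ) * X ^ (2 * k)) →
        (∀ x : α → ℂ, (∀ v ∈ G.vertexSet, ‖x v‖ < t ^ (-1 / (2 * (k : ℝ)))) →
          MvPolynomial.eval x (SubgraphZeros.partitionPoly G hV hE lam u) ≠ 0) ∧
        (∀ x : α → ℂ, (∀ v ∈ G.vertexSet, t ^ (-1 / (2 * (k : ℝ))) < ‖x v‖) →
          MvPolynomial.eval x (SubgraphZeros.partitionPoly G hV hE lam u) ≠ 0) ∧
        ∃ P : ℂ[X],
          SubgraphZeros.IsSqrtDiagonal (SubgraphZeros.partitionPoly G hV hE lam u) P ∧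
          ∀ y : ℂ, P.IsRoot y → ‖y‖ = t ^ (-1 / (k : ℝ))) := by
  open SubgraphZeros in
  refine ⟨fun lam u hlam hkey => ?_, fun u hu => ⟨fun v hv => geom_key_on_circle (hu v hv), ?_⟩,
    fun y hy => ?_, fun k t hk hkt => ?_⟩
  · simpa using zeros_of_keys_on_circle hV hE zero_le_one hlam hkey
  · rintro y s rfl
    exact eval_partitionPoly_eq_binomialSum hV hE hu s
  -- The binomial sum carries no activities; the inverse binomial coefficients are chosen to realize
  -- the keys 1 + z + ⋯ + z^d.
  · obtain ⟨-, -, P, hP, hroot⟩ := zeros_of_keys_on_circle hV hE (lam := fun _ => 1) zero_le_one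
      (fun _ _ => norm_one) fun v _ => geom_key_on_circle (keyPoly_inv_choose G v)
    obtain ⟨s, rfl⟩ := IsAlgClosed.exists_pow_nat_eq y two_pos
    rw [hroot (s ^ 2) ((hP _ s rfl).trans ?_), one_pow]
    rw [eval_partitionPoly_eq_binomialSum hV hE fun v _ => keyPoly_inv_choose G v, hy]
  · have ht : 0 < t := by
      have : (0 : ℝ) < (2 * k).choose k := by exact_mod_cast Nat.choose_pos (by omega)
      nlinarith
    have hzero : ∀ z : ℂ, 1 + ((2 * k).choose k : ℂ) * z ^ k + (t : ℂ) * z ^ (2 * k) = 0 →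
        ‖z‖ = t ^ (-1 / (2 * (k : ℝ))) := fun z hz =>
      norm_eq_rpow_of_trinomial hk ht hkt (by simpa using hz)
    refine ⟨hzero, fun lam u hlam hreg hkey => ?_⟩
    have hsq : (t ^ (-1 / (2 * (k : ℝ)))) ^ 2 = t ^ (-1 / (k : ℝ)) := by
      have hk0 : (k : ℝ) ≠ 0 := by exact_mod_cast (by omega : k ≠ 0)
      rw [← Real.rpow_natCast, ← Real.rpow_mul ht.le]
      congr 1
      push_cast
      field_simp
    rw [← hsq]
    refine zeros_of_keys_on_circle hV hE (Real.rpow_nonneg ht.le _) hlam fun v hv => ?_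
    rw [hkey v hv, hreg v hv]
    refine ⟨degree_trinomial_key hk _ (by exact_mod_cast ht.ne'), fun z hz => hzero z ?_⟩
    simpa using hz
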